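/- Let $A\in\mathbb{C}^{n\times n}$ have minimal polynomial $m_A$ of degree $l$. For $u,v\in\mathbb{C}^n$ put $B(\tau)=A+\tau uv^*$, and let $p_{uv}(z)=v^*m_A(z)(zI_n-A)^{-1}u$, which is a polynomial in $z$. A zero of the polynomial $\det(zI_n-A)/m_A(z)$ is called a structurally frozen eigenvalue of $A$; a common zero of $m_A$ and $p_{uv}$ is called an accidentally frozen eigenvalue. Say that $(u,v)$ is good if there are functions $\lambda_1,\dots,\lambda_l:(0,\infty)\to\mathbb{C}$ such that (i) for every $\tau\in(0,\infty)$ the eigenvalues of $B(\tau)$ that are not eigenvalues of $A$ are exactly $\lambda_1(\tau),\dots,\lambda_l(\tau)$, each of algebraic multiplicity one; and these functions are unique up to ordering: if $\mu_1,\dots,\mu_l:(0,\infty)\to\mathbb{C}$ are continuous and, for every $\tau>0$, $\{\mu_1(\tau),\dots,\mu_l(\tau)\}$ is the set of eigenvalues of $B(\tau)$ that are not eigenvalues of $A$, then $\mu_j=\lambda_{s(j)}$ for all $j$, for some permutation $s$ of $\{1,\dots,l\}$; (ii) for every $\tau\in(0,\infty)$ the remaining part of the spectrum of $B(\tau)$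 consists of structurally frozen eigenvalues of $A$, and there are no accidentally frozen eigenvalues; (iii) $\lambda_i(\tau)\neq\lambda_j(\tilde\tau)$ for all $i\neq j$ and all $\tau,\tilde\tau\in(0,\infty)$; (iv) the functions $\lambda_1,\dots,\lambda_l$ extend to analytic functions on some open complex neighbourhood of $(0,\infty)$. Call $u\in\mathbb{C}^n$ admissible if every polynomial $q$ with $q(A)u=0$ satisfies $q(A)=0$. Then: (a) the set of $u\in\mathbb{C}^n$ that are not admissible is closed and has empty interior; (b) for every fixed admissible $u$, the pair $(u,v)$ is good for all $v\in\mathbb{C}^n$ outside some closed set with empty interior; (c) the pair $(u,v)$ is good for all $(u,v)\in\mathbb{C}^n\times\mathbb{C}^n$ outside some closed set with empty interior. -/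

import Mathlib

open Polynomial Matrix

/-- The rank one perturbation `B(τ) = A + τ u v^*`. -/
def pert {n : ℕ} (A : Matrix (Fin n) (Fin n) ℂ) (u v : Fin n → ℂ) (τ : ℂ) :
    Matrix (Fin n) (Fin n) ℂ :=
  A + τ • vecMulVec u (star v)

/-- The polynomial `p_{uv}(z) = v^* m_A(z) (z I - A)⁻¹ u`, where `m_A` is the minimal polynomial
of `A`. With `m_A = ∑ c_k X^k` one has
`m_A(z) (z I - A)⁻¹ = ∑_k c_k ∑_{i<k} z^i A^{k-1-i}`, see `puv_eval`. -/
noncomputable def puv {n : ℕ} (A : Matrix (Fin n) (Fin n) ℂ) (u v : Fin n → ℂ) : ℂ[X] :=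
  ∑ k ∈ Finset.range ((minpoly ℂ A).natDegree + 1), ∑ i ∈ Finset.range k,
    C ((minpoly ℂ A).coeff k * (star v ⬝ᵥ (A ^ (k - 1 - i) *ᵥ u))) * X ^ i

/-- The defining property of `puv`. -/
theorem puv_eval {n : ℕ} (A : Matrix (Fin n) (Fin n) ℂ) (u v : Fin n → ℂ) (z : ℂ)
    (hz : z ∉ spectrum ℂ A) :
    (puv A u v).eval z
      = star v ⬝ᵥ (((minpoly ℂ A).eval z • (z • (1 : Matrix (Fin n) (Fin n) ℂ) - A)⁻¹) *ᵥ u) := by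
  have hu : IsUnit (z • (1 : Matrix (Fin n) (Fin n) ℂ) - A) := by
    rw [spectrum.notMem_iff, Algebra.algebraMap_eq_smul_one] at hz
    exact hz
  have hdet : IsUnit (z • (1 : Matrix (Fin n) (Fin n) ℂ) - A).det :=
    (Matrix.isUnit_iff_isUnit_det _).1 hu
  have hcomm : Commute (z • (1 : Matrix (Fin n) (Fin n) ℂ)) A :=
    (Commute.one_left A).smul_left z
  have key : (minpoly ℂ A).eval z • (z • (1 : Matrix (Fin n) (Fin n) ℂ) - A)⁻¹
      = ∑ k ∈ Finset.range ((minpoly ℂ A).natDegree + 1), ∑ i ∈ Finset.range k,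
        ((minpoly ℂ A).coeff k * z ^ i) • A ^ (k - 1 - i) := by
    have h1 : (∑ k ∈ Finset.range ((minpoly ℂ A).natDegree + 1), ∑ i ∈ Finset.range k,
        ((minpoly ℂ A).coeff k * z ^ i) • A ^ (k - 1 - i))
          * (z • (1 : Matrix (Fin n) (Fin n) ℂ) - A)
        = (minpoly ℂ A).eval z • (1 : Matrix (Fin n) (Fin n) ℂ) := by
      have h0 := minpoly.aeval ℂ A
      rw [aeval_eq_sum_range] at h0
      rw [← sub_zero ((minpoly ℂ A).eval z • (1 : Matrix (Fin n) (Fin n) ℂ)), ← h0,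
        eval_eq_sum_range, Finset.sum_smul, ← Finset.sum_sub_distrib, Finset.sum_mul]
      refine Finset.sum_congr rfl fun k _ => ?_
      have h2 := hcomm.geom_sum₂_mul k
      rw [_root_.smul_pow, one_pow] at h2
      rw [mul_smul, ← smul_sub, ← h2, ← smul_mul_assoc, Finset.smul_sum]
      congr 1
      refine Finset.sum_congr rfl fun i _ => ?_
      rw [_root_.smul_pow, one_pow, mul_smul, smul_mul_assoc, one_mul]
    calc _ = ((minpoly ℂ A).eval z • (1 : Matrix (Fin n) (Fin n) ℂ))
            * (z • (1 : Matrix (Fin n) (Fin n) ℂ) - A)⁻¹ := by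
          rw [smul_mul_assoc, one_mul]
      _ = _ := by
          rw [← h1, mul_assoc, Matrix.mul_nonsing_inv _ hdet, mul_one]
  rw [key, puv, eval_finsetSum, Matrix.sum_mulVec, dotProduct_sum]
  refine Finset.sum_congr rfl fun k _ => ?_
  rw [eval_finsetSum, Matrix.sum_mulVec, dotProduct_sum]
  refine Finset.sum_congr rfl fun i _ => ?_
  rw [Matrix.smul_mulVec, dotProduct_smul, smul_eq_mul]
  simp only [eval_mul, eval_C, eval_pow, eval_X]
  ring

/-- `z` is a structurally frozen eigenvalue of `A`: a zero of `det(z I - A) / m_A(z)`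
(the minimal polynomial divides the characteristic polynomial, so the division is exact). -/
def StructurallyFrozen {n : ℕ} (A : Matrix (Fin n) (Fin n) ℂ) (z : ℂ) : Prop :=
  (A.charpoly / minpoly ℂ A).IsRoot z

/-- `z` is an eigenvalue of `A` accidentally frozen by `u, v`: a common zero of `m_A`
and `p_{uv}`. -/
def AccidentallyFrozen {n : ℕ} (A : Matrix (Fin n) (Fin n) ℂ) (u v : Fin n → ℂ) (z : ℂ) : Prop :=
  (minpoly ℂ A).IsRoot z ∧ (puv A u v).IsRoot z

/-- For every `τ > 0` the eigenvalues of `B(τ)` that are not eigenvalues of `A` are exactly the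
values at `τ` of the functions `lam j`. -/
def ListsMovingEigenvalues {n l : ℕ} (A : Matrix (Fin n) (Fin n) ℂ) (u v : Fin n → ℂ)
    (lam : Fin l → ℝ → ℂ) : Prop :=
  ∀ τ : ℝ, 0 < τ →
    spectrum ℂ (pert A u v τ) \ spectrum ℂ A = Set.range (fun j => lam j τ)

/-- The global description of the spectrum of `B(τ)`, `τ > 0`, by `l` analytic branches,
where `l` is the degree of the minimal polynomial of `A`. -/
structure GlobalBranches {n : ℕ} (A : Matrix (Fin n) (Fin n) ℂ) (u v : Fin n → ℂ)
    (lam : Fin (minpoly ℂ A).natDegree → ℝ → ℂ) : Prop where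
  /-- the branches are the eigenvalues of `B(τ)` which are not eigenvalues of `A` -/
  lists : ListsMovingEigenvalues A u v lam
  /-- ... each of them of algebraic multiplicity one -/
  simple : ∀ j, ∀ τ : ℝ, 0 < τ → (pert A u v τ).charpoly.rootMultiplicity (lam j τ) = 1
  /-- the branches are unique up to ordering, among continuous functions of `τ` -/
  unique : ∀ mu : Fin (minpoly ℂ A).natDegree → ℝ → ℂ,
    (∀ j, ContinuousOn (mu j) (Set.Ioi 0)) → ListsMovingEigenvalues A u v mu →
    ∃ s : Equiv.Perm (Fin (minpoly ℂ A).natDegree), ∀ j, ∀ τ : ℝ, 0 < τ → mu j τ = lam (s j) τ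
  /-- the rest of the spectrum of `B(τ)` consists of structurally frozen eigenvalues of `A` -/
  rest : ∀ τ : ℝ, 0 < τ → ∀ z ∈ spectrum ℂ (pert A u v τ),
    z ∈ spectrum ℂ A → StructurallyFrozen A z
  /-- there are no accidentally frozen eigenvalues -/
  not_accidental : ∀ z, ¬ AccidentallyFrozen A u v z
  /-- distinct branches never meet, even at different parameters -/
  disjoint : ∀ i j, i ≠ j → ∀ τ τ' : ℝ, 0 < τ → 0 < τ' → lam i τ ≠ lam j τ'
  /-- the branches extend analytically to an open complex neighbourhood of `(0, ∞)` -/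
  analytic : ∃ U : Set ℂ, IsOpen U ∧ (∀ τ : ℝ, 0 < τ → (τ : ℂ) ∈ U) ∧
    ∀ j, ∃ g : ℂ → ℂ, AnalyticOnNhd ℂ g U ∧ ∀ τ : ℝ, 0 < τ → g τ = lam j τ

/-- No polynomial in `A` annihilates the vector `u` unless it annihilates the whole space;
that is, the minimal polynomial of `A` relative to `u` is the minimal polynomial of `A`. -/
def FullMinpolyVector {n : ℕ} (A : Matrix (Fin n) (Fin n) ℂ) (u : Fin n → ℂ) : Prop :=
  ∀ q : ℂ[X], aeval A q *ᵥ u = 0 → aeval A q = 0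

/-!
With `m = m_A`, `p = p_{uv}` and `l = deg m`, the matrix determinant lemma gives
`det (z - B(τ)) = (det (z - A) / m) (m - τ p)` (`charpoly_pert`). If `m` and `p` have no common
zero, the moving eigenvalues are therefore the zeros of `m - τ p`, that is, the fibre over `τ` of
the rational function `f = m / p`. Two branches at different parameters cannot meet because `f` is
a function.

Since `deg p < deg m`, the function `f` is a closed map from the complement of the zeros of `p` to
the plane, hence a covering over its regular values (`isCoveringMapOn_eval_div_eval`). If none of
the finitely many critical values is a positive real, some convex open neighbourhood of `(0, ∞)`
contains none of them. It is simply connected, so the covering has `l` disjoint sections over it,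
which are local inverses of `f` and hence analytic (`exists_analytic_branches`). This reduces the
theorem to showing that generically `m` and `p` have no common zero and `f` has no positive critical
value (`exists_globalBranches`).

The zeros of `m' p - m p'` include the multiple zeros of `m`, with critical value `0`, which lies
in the closure of `(0, ∞)`. For the exceptional set to be closed these are divided out: the reduced
Wronskian `(m' p - m p') / gcd (m, m')` does not vanish at the zeros of `m` if `p` does not. Its top
coefficient is that of `p` up to a constant, since `l` and `l - 1` do not cancel, so its zeros stay
bounded locally and the condition that one of them has a nonnegative critical value is closed once
the top coefficient is required not to vanish (`isClosed_coeff_eq_zero_or_exists_isRoot`,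
`isClosed_exceptionalPairs`). For admissible `u` it is also nowhere dense in `v`: small changes of
`v` give `p` full degree and make it separable and coprime to `m`
(`FullMinpolyVector.exists_mem_simple`); multiplying `v` by `1 + i t` then fixes the critical points
and rotates the critical values off the real line (`FullMinpolyVector.interior_exceptionalPairs`).
Finally, the vectors that are not admissible form a finite union of proper subspaces, the kernels
of `(m / (X - z))(A)` for the zeros `z` of `m` (`not_fullMinpolyVector_iff`).
-/

/-! ### Roots of a continuous family of polynomials -/

theorem continuous_eval_of_continuous_coeff {W : Type*} [TopologicalSpace W] {F : W → ℂ[X]} {D : ℕ}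
    (hF : ∀ i, Continuous fun w => (F w).coeff i) (hD : ∀ w, (F w).natDegree ≤ D) :
    Continuous fun x : W × ℂ => (F x.1).eval x.2 := by
  simp only [eval_eq_sum_range' (Nat.lt_succ_of_le (hD _))]
  exact continuous_finsetSum _ fun i _ => ((hF i).comp continuous_fst).mul (continuous_snd.pow i)

/-- As long as the coefficient of the top degree `D` does not vanish, the roots of a continuous
family of polynomials stay in a bounded set, so a closed condition on a root remains closed after
the root is projected away. -/
theorem isClosed_coeff_eq_zero_or_exists_isRoot {W : Type*} [TopologicalSpace W] (F : W → ℂ[X])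
    (D : ℕ) (hF : ∀ i, Continuous fun w => (F w).coeff i) (hD : ∀ w, (F w).natDegree ≤ D)
    (K : Set (W × ℂ)) (hK : IsClosed K) :
    IsClosed {w | (F w).coeff D = 0 ∨ ∃ z, (F w).IsRoot z ∧ (w, z) ∈ K} := by
  have heval : ∀ (w : W) (z : ℂ),
      (F w).eval z = ∑ i ∈ Finset.range (D + 1), (F w).coeff i * z ^ i := fun w z =>
    eval_eq_sum_range' (Nat.lt_succ_of_le (hD w)) z
  -- Cauchy's bound, with the denominator cleared so that both sides are continuous in `w`
  have hbound : ∀ (w : W) (z : ℂ), (F w).IsRoot z →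
      ‖z‖ * ‖(F w).coeff D‖ ≤ ‖(F w).coeff D‖ + ∑ i ∈ Finset.range D, ‖(F w).coeff i‖ := by
    intro w z hz
    have hS : 0 ≤ ∑ i ∈ Finset.range D, ‖(F w).coeff i‖ :=
      Finset.sum_nonneg fun i _ => norm_nonneg _
    rcases le_total ‖z‖ 1 with h1 | h1
    · nlinarith [mul_le_mul_of_nonneg_right h1 (norm_nonneg ((F w).coeff D))]
    · have h0 : (F w).eval z = 0 := hz
      rw [heval, Finset.sum_range_succ] at h0
      rcases Nat.eq_zero_or_pos D with rfl | hDpos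
      · simp only [Finset.range_zero, Finset.sum_empty, pow_zero, mul_one, zero_add] at h0 ⊢
        simp [h0]
      have h2 : ‖(F w).coeff D‖ * ‖z‖ ^ D
          ≤ (∑ i ∈ Finset.range D, ‖(F w).coeff i‖) * ‖z‖ ^ (D - 1) := by
        rw [← norm_pow, ← norm_mul, eq_neg_of_add_eq_zero_right h0, norm_neg, Finset.sum_mul]
        refine (norm_sum_le _ _).trans (Finset.sum_le_sum fun i hi => ?_)
        rw [norm_mul, norm_pow]
        have := Finset.mem_range.1 hi
        exact mul_le_mul_of_nonneg_left (pow_le_pow_right₀ h1 (by omega)) (norm_nonneg _)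
      have h3 : ‖z‖ ^ D = ‖z‖ ^ (D - 1) * ‖z‖ := by
        rw [← pow_succ]; congr 1; omega
      have h4 : 0 < ‖z‖ ^ (D - 1) := by positivity
      rw [h3] at h2
      have h5 : ‖z‖ * ‖(F w).coeff D‖ ≤ ∑ i ∈ Finset.range D, ‖(F w).coeff i‖ :=
        le_of_mul_le_mul_right (by linarith) h4
      linarith [norm_nonneg ((F w).coeff D)]
  rw [← isOpen_compl_iff, isOpen_iff_mem_nhds]
  intro w₀ hw₀
  simp only [Set.mem_compl_iff, Set.mem_ofPred_eq, not_or] at hw₀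
  obtain ⟨hc₀, hroot₀⟩ := hw₀
  set c := ‖(F w₀).coeff D‖ with hc
  have hcpos : 0 < c := norm_pos_iff.2 hc₀
  set S := ‖(F w₀).coeff D‖ + ∑ i ∈ Finset.range D, ‖(F w₀).coeff i‖ with hSdef
  have hScont : Continuous fun w =>
      ‖(F w).coeff D‖ + ∑ i ∈ Finset.range D, ‖(F w).coeff i‖ :=
    (hF D).norm.add (continuous_finsetSum _ fun i _ => (hF i).norm)
  set R := (S + 1) / (c / 2) with hR
  have hclosed :
      IsClosed {w | ∃ z ∈ Metric.closedBall (0 : ℂ) R, (F w).eval z = 0 ∧ (w, z) ∈ K} := by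
    have hcomp : CompactSpace (Metric.closedBall (0 : ℂ) R) :=
      isCompact_iff_compactSpace.1 (isCompact_closedBall 0 R)
    have h1 : IsClosed {x : W × Metric.closedBall (0 : ℂ) R |
        (F x.1).eval (x.2 : ℂ) = 0 ∧ (x.1, (x.2 : ℂ)) ∈ K} := by
      refine IsClosed.inter ?_ (hK.preimage (by fun_prop))
      exact isClosed_eq ((continuous_eval_of_continuous_coeff hF hD).comp
        (by fun_prop : Continuous fun x : W × Metric.closedBall (0 : ℂ) R => (x.1, (x.2 : ℂ))))
        continuous_const
    convert isClosedMap_fst_of_compactSpace _ h1 using 1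
    ext w
    simp only [Set.mem_ofPred_eq, Set.mem_image, Prod.exists, Subtype.exists, exists_and_right,
      exists_eq_right]
    constructor
    · rintro ⟨z, hz, h, hK⟩; exact ⟨z, ⟨hz, h⟩, hK⟩
    · rintro ⟨z, ⟨hz, h⟩, hK⟩; exact ⟨z, hz, h, hK⟩
  have e1 : ∀ᶠ w in nhds w₀, c / 2 < ‖(F w).coeff D‖ :=
    (hF D).norm.continuousAt.eventually (lt_mem_nhds (by linarith : c / 2 < c))
  have e2 := hScont.continuousAt.eventually (gt_mem_nhds (lt_add_one S))
  have e3 := hclosed.isOpen_compl.mem_nhds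
    (show w₀ ∈ _ from fun ⟨z, _, hz, hzK⟩ => hroot₀ ⟨z, hz, hzK⟩)
  filter_upwards [e1, e2, e3] with w h1 h2 h3
  simp only [Set.mem_compl_iff, Set.mem_ofPred_eq, not_or]
  refine ⟨fun h => ?_, fun ⟨z, hz, hzK⟩ => h3 ⟨z, ?_, hz, hzK⟩⟩
  · rw [h, norm_zero] at h1; linarith
  · rw [mem_closedBall_zero_iff, hR, le_div_iff₀ (by positivity)]
    have := hbound w z hz
    nlinarith [norm_nonneg z]

/-! ### The covering `m / p` -/

/-- If `p` has smaller degree than the monic polynomial `m` and no root in common with it, the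
rational function `m / p` is a closed map from the complement of the poles to the plane: the
preimages of a bounded set are roots of the polynomials `m - y p` with `y` bounded. -/
theorem isClosedMap_eval_div_eval {m p : ℂ[X]} (hm : m.Monic) (hdeg : p.natDegree < m.natDegree)
    (hcop : ∀ z, ¬ (m.IsRoot z ∧ p.IsRoot z)) :
    IsClosedMap fun z : {z : ℂ // p.eval z ≠ 0} => m.eval (z : ℂ) / p.eval (z : ℂ) := by
  intro C hC
  obtain ⟨C', hC', rfl⟩ := isClosed_induced_iff.1 hC
  have hcoeff : ∀ y : ℂ, (m - Polynomial.C y * p).coeff m.natDegree = 1 := fun y => by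
    rw [coeff_sub, coeff_C_mul, coeff_eq_zero_of_natDegree_lt hdeg, mul_zero, sub_zero,
      hm.coeff_natDegree]
  have h := isClosed_coeff_eq_zero_or_exists_isRoot (fun y : ℂ => m - Polynomial.C y * p)
    m.natDegree (fun i => by simp only [coeff_sub, coeff_C_mul]; fun_prop)
    (fun y => (natDegree_sub_le _ _).trans
      (max_le le_rfl ((natDegree_C_mul_le _ _).trans hdeg.le)))
    (Prod.snd ⁻¹' C') (hC'.preimage continuous_snd)
  convert h using 1
  ext y
  simp only [hcoeff, one_ne_zero, false_or, Set.mem_image, Set.mem_preimage, Set.mem_ofPred_eq,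
    Subtype.exists, IsRoot.def, eval_sub, eval_mul, eval_C]
  constructor
  · rintro ⟨z, hz, hzC, rfl⟩
    exact ⟨z, by field_simp; ring, hzC⟩
  · rintro ⟨z, hz, hzC⟩
    have hpz : p.eval z ≠ 0 := fun h0 => hcop z ⟨by simpa [h0] using hz, h0⟩
    exact ⟨z, hpz, hzC, by rw [div_eq_iff hpz]; linear_combination hz⟩

/-- The Wronskian `m' p - m p'` is the numerator of `(m / p)'`. -/
theorem hasStrictDerivAt_eval_div_eval {m p : ℂ[X]} {z : ℂ} (hz : p.eval z ≠ 0) :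
    HasStrictDerivAt (fun z => m.eval z / p.eval z)
      ((derivative m * p - m * derivative p).eval z / p.eval z ^ 2) z := by
  simpa using (m.hasStrictDerivAt z).fun_div (p.hasStrictDerivAt z) hz

theorem finite_setOf_eval_eq_mul_eval {m p : ℂ[X]} (hdeg : p.natDegree < m.natDegree) (y : ℂ) :
    {z | m.eval z = y * p.eval z}.Finite := by
  have h0 : m - C y * p ≠ 0 := fun h => by
    have := (natDegree_C_mul_le y p).trans_lt hdeg
    rw [← sub_eq_zero.1 h] at this
    exact lt_irrefl _ this
  refine ((m - C y * p).roots.toFinset.finite_toSet).subset fun z hz => ?_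
  have hz' : m.eval z = y * p.eval z := hz
  simp [h0, hz']

/-- `m / p` is a covering map over the set of its regular values. -/
theorem isCoveringMapOn_eval_div_eval {m p : ℂ[X]} (hm : m.Monic)
    (hdeg : p.natDegree < m.natDegree) (hcop : ∀ z, ¬ (m.IsRoot z ∧ p.IsRoot z)) :
    IsCoveringMapOn (fun z : {z : ℂ // p.eval z ≠ 0} => m.eval (z : ℂ) / p.eval (z : ℂ))
      {y | ∀ z, (derivative m * p - m * derivative p).IsRoot z → m.eval z ≠ y * p.eval z} := by
  refine (isClosedMap_eval_div_eval hm hdeg hcop).isCoveringMapOn_of_isLocalHomeomorphOn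
    (fun y _ => ?_) ?_
  · refine Set.Finite.of_finite_image
      ((finite_setOf_eval_eq_mul_eval hdeg y).subset ?_)
      Subtype.val_injective.injOn
    rintro _ ⟨z, hz, rfl⟩
    exact (div_eq_iff z.2).1 hz
  · have hopen : IsOpen {z : ℂ | p.eval z ≠ 0} := isOpen_ne_fun (by fun_prop) continuous_const
    have hval : IsLocalHomeomorph (Subtype.val : {z : ℂ // p.eval z ≠ 0} → ℂ) :=
      hopen.isOpenEmbedding_subtypeVal.isLocalHomeomorph
    refine IsLocalHomeomorphOn.comp (g := fun z : ℂ => m.eval z / p.eval z)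
      (t := {z | p.eval z ≠ 0 ∧ ¬ (derivative m * p - m * derivative p).IsRoot z}) ?_
      (hval.isLocalHomeomorphOn (s := _)) ?_
    · rintro z ⟨hz, hz'⟩
      exact ⟨_, ((hasStrictDerivAt_eval_div_eval hz).hasStrictFDerivAt_equiv
        (div_ne_zero hz' (pow_ne_zero 2 hz))).mem_toOpenPartialHomeomorph_source, by simp⟩
    · intro z hz
      exact ⟨z.2, fun h => hz z h (by field_simp [z.2])⟩

/-! ### Analytic branches along the positive half-line -/

/-- A finite set avoiding the positive half-line is avoided by an open convex neighbourhood of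
the half-line, an intersection of half-planes with boundary through the origin. -/
theorem exists_isOpen_convex_disjoint {S : Set ℂ} (hS : S.Finite)
    (hpos : ∀ τ : ℝ, 0 < τ → (τ : ℂ) ∉ S) :
    ∃ U : Set ℂ, IsOpen U ∧ Convex ℝ U ∧ (∀ τ : ℝ, 0 < τ → (τ : ℂ) ∈ U) ∧ Disjoint U S := by
  induction S, hS using Set.Finite.induction_on with
  | empty => exact ⟨Set.univ, isOpen_univ, convex_univ, fun _ _ => trivial, by simp⟩
  | @insert s S _ _ ih =>
    obtain ⟨U, hU, hUc, hUpos, hUS⟩ := ih fun τ hτ h => hpos τ hτ (Set.mem_insert_of_mem _ h)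
    have hs : ¬ (0 < s.re ∧ s.im = 0) := fun h =>
      hpos s.re h.1 (Set.mem_insert_iff.2 (Or.inl (Complex.ext (by simp) (by simp [h.2]))))
    obtain ⟨L, hL, hLs⟩ : ∃ L : ℂ →L[ℝ] ℝ, (∀ τ : ℝ, 0 < τ → 0 < L τ) ∧ L s ≤ 0 := by
      rcases lt_trichotomy s.im 0 with h | h | h
      · refine ⟨s.re • Complex.imCLM - s.im • Complex.reCLM, fun τ hτ => ?_, ?_⟩
        · simp; nlinarith
        · simp [mul_comm]
      · exact ⟨Complex.reCLM, fun τ hτ => by simpa using hτ,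
          not_lt.1 fun h' => hs ⟨h', h⟩⟩
      · refine ⟨s.im • Complex.reCLM - s.re • Complex.imCLM, fun τ hτ => ?_, ?_⟩
        · simp; nlinarith
        · simp [mul_comm]
    refine ⟨U ∩ {w | 0 < L w}, hU.inter (isOpen_lt continuous_const L.continuous),
      hUc.inter (convex_halfSpace_gt L.isLinear 0), fun τ hτ => ⟨hUpos τ hτ, hL τ hτ⟩, ?_⟩
    rw [Set.disjoint_left] at hUS ⊢
    rintro w ⟨hwU, hwL⟩ (rfl | hwS)
    · exact absurd hwL (not_lt.2 hLs)
    · exact hUS hwU hwS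

theorem derivative_mul_sub_mul_derivative_ne_zero {m p : ℂ[X]} (hl : 0 < m.natDegree)
    (hcop : ∀ z, ¬ (m.IsRoot z ∧ p.IsRoot z)) : derivative m * p - m * derivative p ≠ 0 := by
  intro h
  have hm0 : m ≠ 0 := by rintro rfl; simp at hl
  have hco : IsCoprime m p := by
    refine isCoprime_of_irreducible_dvd (fun h0 => hm0 h0.1) fun q hq hqm hqp => ?_
    obtain ⟨z, hz⟩ := IsAlgClosed.exists_root q (degree_pos_of_irreducible hq).ne'
    exact hcop z ⟨hz.dvd hqm, hz.dvd hqp⟩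
  have hdvd : m ∣ derivative m :=
    hco.dvd_of_dvd_mul_right ⟨derivative p, sub_eq_zero.1 h⟩
  have h1 : derivative m = 0 := eq_zero_of_dvd_of_degree_lt hdvd (degree_derivative_lt hm0)
  exact hl.ne' (derivative_eq_zero.1 h1)

/-- If `m` and `p` have no common root and no positive real number is a critical value of `m / p`,
the roots of `m - τ p`, `τ > 0`, are parametrized by `deg m` analytic functions with pairwise
distinct values: the sections, over a simply connected neighbourhood of the half-line free of
critical values, of the covering `m / p`. -/
theorem exists_analytic_branches {m p : ℂ[X]} (hm : m.Monic) (hdeg : p.natDegree < m.natDegree)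
    (hcop : ∀ z, ¬ (m.IsRoot z ∧ p.IsRoot z))
    (hcrit : ∀ z, (derivative m * p - m * derivative p).IsRoot z →
      ∀ τ : ℝ, 0 < τ → m.eval z ≠ τ * p.eval z) :
    ∃ (U : Set ℂ) (g : Fin m.natDegree → ℂ → ℂ), IsOpen U ∧ (∀ τ : ℝ, 0 < τ → (τ : ℂ) ∈ U) ∧
      (∀ j, AnalyticOnNhd ℂ (g j) U) ∧
      ∀ s ∈ U, Function.Injective (fun j => g j s) ∧
        ∀ j, m.eval (g j s) = s * p.eval (g j s) := by
  have hW0 := derivative_mul_sub_mul_derivative_ne_zero (p := p) (by omega : 0 < m.natDegree) hcop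
  set Wr := derivative m * p - m * derivative p with hWr
  obtain ⟨U, hU, hUc, hUpos, hUS⟩ := exists_isOpen_convex_disjoint
    (S := (fun z => m.eval z / p.eval z) '' (Wr.roots.toFinset : Set ℂ))
    (Wr.roots.toFinset.finite_toSet.image _) (by
      rintro τ hτ ⟨z, hz, hzτ⟩
      have hz' : Wr.IsRoot z := by simpa [hW0] using hz
      have hpz : p.eval z ≠ 0 := fun h => by
        simp only [h, div_zero] at hzτ
        exact hτ.ne' (by exact_mod_cast hzτ.symm)
      exact hcrit z hz' τ hτ ((div_eq_iff hpz).1 hzτ))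
  have hreg : ∀ s ∈ U, ∀ z, Wr.IsRoot z → m.eval z ≠ s * p.eval z := by
    intro s hs z hz h
    have hpz : p.eval z ≠ 0 := fun h0 => hcop z ⟨by simpa [h0] using h, h0⟩
    exact Set.disjoint_left.1 hUS hs ⟨z, by simpa [hW0] using hz, (div_eq_iff hpz).2 h⟩
  have h1U : (1 : ℂ) ∈ U := by simpa using hUpos 1 one_pos
  have : ContractibleSpace U := hUc.contractibleSpace ⟨1, h1U⟩
  have : LocallyPathConnectedSpace U := hU.locallyPathConnectedSpace
  have cov := isCoveringMapOn_eval_div_eval hm hdeg hcop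
  let ι : C(U, ℂ) := ⟨Subtype.val, continuous_subtype_val⟩
  have lift := fun (a : U) (e : {z : ℂ // p.eval z ≠ 0})
      (he : m.eval (e : ℂ) / p.eval (e : ℂ) = ι a) =>
    cov.existsUnique_continuousMap_lifts ι he fun a => hreg a a.2
  -- the `deg m` starting points are the roots of `m - p`, which are simple since `1` is regular
  have hdeg1 : (C 1 * p).degree < m.degree := by
    rw [C_1, one_mul]; exact degree_lt_degree hdeg
  have hmon1 : (m - C 1 * p).Monic := hm.sub_of_left hdeg1
  have hnodup : (m - C 1 * p).roots.Nodup := by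
    rw [nodup_roots_iff_of_splits hmon1.ne_zero (IsAlgClosed.splits _)]
    rw [Polynomial.Separable]
    refine isCoprime_of_irreducible_dvd (fun h0 => hmon1.ne_zero h0.1) fun q hq hqm hqp => ?_
    obtain ⟨z, hz⟩ := IsAlgClosed.exists_root q (degree_pos_of_irreducible hq).ne'
    have r1 : m.eval z - p.eval z = 0 := by simpa using hz.dvd hqm
    have r2 : (derivative m).eval z - (derivative p).eval z = 0 := by simpa using hz.dvd hqp
    refine hreg 1 h1U z ?_ (by linear_combination r1)
    rw [hWr]
    simp only [IsRoot.def, eval_sub, eval_mul]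
    linear_combination (p.eval z) * r2 - (derivative p).eval z * r1
  have hcard : (m - C 1 * p).roots.toFinset.card = m.natDegree := by
    rw [Multiset.toFinset_card_of_nodup hnodup,
      splits_iff_card_roots.1 (IsAlgClosed.splits _)]
    exact natDegree_eq_of_degree_eq (degree_sub_eq_left_of_degree_lt hdeg1)
  let φ := (Finset.equivFinOfCardEq hcard).symm
  have hroot : ∀ j, m.eval (φ j : ℂ) = p.eval (φ j : ℂ) := fun j => by
    have h := (mem_roots hmon1.ne_zero).1 (Multiset.mem_toFinset.1 (φ j).2)
    simp only [IsRoot.def, eval_sub, eval_mul, eval_C] at h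
    linear_combination h
  have hp : ∀ j, p.eval (φ j : ℂ) ≠ 0 := fun j h => hcop _ ⟨(hroot j).trans h, h⟩
  choose G hG _ using fun j => lift ⟨1, h1U⟩ ⟨φ j, hp j⟩ (by
    show m.eval (φ j : ℂ) / p.eval (φ j : ℂ) = 1
    rw [hroot, div_self (hp j)])
  have hGs : ∀ j (a : U), m.eval (G j a : ℂ) / p.eval (G j a : ℂ) = a := fun j a =>
    congrFun (hG j).2 a
  have hGinj : ∀ a : U, Function.Injective fun j => (G j a : ℂ) := by
    intro a i j hij
    have hF := (lift a (G j a) (hGs j a)).unique (y₁ := G i) (y₂ := G j)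
      ⟨Subtype.ext hij, (hG i).2⟩ ⟨rfl, (hG j).2⟩
    have h1 := (hG i).1
    rw [hF, (hG j).1] at h1
    exact φ.injective (Subtype.ext (Subtype.ext_iff.1 h1).symm)
  classical
  let g : Fin m.natDegree → ℂ → ℂ := fun j s => if h : s ∈ U then (G j ⟨s, h⟩ : ℂ) else 0
  have hg : ∀ j (a : U), g j a = G j a := fun j a => by simp [g]
  refine ⟨U, g, hU, hUpos, fun j => ?_, fun s hs => ⟨fun i j hij => hGinj ⟨s, hs⟩ ?_, fun j => ?_⟩⟩
  · refine DifferentiableOn.analyticOnNhd (fun s hs => ?_) hU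
    have hcont : ContinuousAt (g j) s := by
      refine ContinuousOn.continuousAt (s := U) ?_ (hU.mem_nhds hs)
      rw [continuousOn_iff_continuous_domRestrict]
      refine (continuous_subtype_val.comp (G j).continuous).congr fun a => ?_
      exact (hg j a).symm
    have hgs : g j s = G j ⟨s, hs⟩ := hg j ⟨s, hs⟩
    have hpg : p.eval (g j s) ≠ 0 := by rw [hgs]; exact (G j ⟨s, hs⟩).2
    have hms : m.eval (g j s) = s * p.eval (g j s) := by
      rw [hgs]; exact (div_eq_iff (G j ⟨s, hs⟩).2).1 (hGs j ⟨s, hs⟩)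
    refine HasDerivAt.differentiableAt
      ((hasStrictDerivAt_eval_div_eval hpg).hasDerivAt.of_local_left_inverse hcont
        (div_ne_zero (fun h => hreg s hs _ h hms) (pow_ne_zero 2 hpg)) ?_)
      |>.differentiableWithinAt
    filter_upwards [hU.mem_nhds hs] with y hy
    rw [hg j ⟨y, hy⟩]
    exact hGs j ⟨y, hy⟩
  · simpa only [hg _ ⟨s, hs⟩] using hij
  · rw [hg j ⟨s, hs⟩]
    exact (div_eq_iff (G j ⟨s, hs⟩).2).1 (hGs j ⟨s, hs⟩)

/-! ### The characteristic polynomial of a rank one perturbation -/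

theorem coeff_puv {n : ℕ} (A : Matrix (Fin n) (Fin n) ℂ) (u v : Fin n → ℂ) (i : ℕ) :
    (puv A u v).coeff i = ∑ k ∈ Finset.range ((minpoly ℂ A).natDegree + 1),
      if i < k then (minpoly ℂ A).coeff k * (star v ⬝ᵥ (A ^ (k - 1 - i) *ᵥ u)) else 0 := by
  simp only [puv, finsetSum_coeff, coeff_C_mul_X_pow]
  refine Finset.sum_congr rfl fun k _ => ?_
  rw [Finset.sum_ite_eq]
  simp only [Finset.mem_range]

theorem degree_puv_lt {n : ℕ} (A : Matrix (Fin n) (Fin n) ℂ) (u v : Fin n → ℂ) :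
    (puv A u v).degree < (minpoly ℂ A).degree := by
  rw [degree_eq_natDegree (minpoly.ne_zero (Matrix.isIntegral A)), degree_lt_iff_coeff_zero]
  intro i hi
  rw [coeff_puv]
  refine Finset.sum_eq_zero fun k hk => if_neg ?_
  rw [Finset.mem_range] at hk
  omega

theorem charpoly_eq_div_mul_minpoly {n : ℕ} (A : Matrix (Fin n) (Fin n) ℂ) :
    A.charpoly = A.charpoly / minpoly ℂ A * minpoly ℂ A :=
  (EuclideanDomain.mul_div_cancel' (minpoly.ne_zero (Matrix.isIntegral A))
    (Matrix.minpoly_dvd_charpoly A)).symm.trans (mul_comm _ _)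

theorem mem_spectrum_iff_isRoot_minpoly {n : ℕ} (A : Matrix (Fin n) (Fin n) ℂ) (z : ℂ) :
    z ∈ spectrum ℂ A ↔ (minpoly ℂ A).IsRoot z := by
  constructor
  · intro hz
    have h := spectrum.subset_polynomial_aeval A (minpoly ℂ A) ⟨z, hz, rfl⟩
    rw [minpoly.aeval] at h
    by_contra hne
    refine h ?_
    rw [spectrum.mem_resolventSet_iff, sub_zero]
    exact (IsUnit.mk0 _ hne).map _
  · intro hz
    rw [Matrix.mem_spectrum_iff_isRoot_charpoly]
    exact hz.dvd (Matrix.minpoly_dvd_charpoly A)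

/-- The matrix determinant lemma, multiplied through by `m_A`. -/
theorem charpoly_pert {n : ℕ} (A : Matrix (Fin n) (Fin n) ℂ) (u v : Fin n → ℂ) (τ : ℂ) :
    (pert A u v τ).charpoly
      = A.charpoly / minpoly ℂ A * (minpoly ℂ A - C τ * puv A u v) := by
  have hfin : {z | z ∈ spectrum ℂ A}.Finite := by
    refine ((minpoly ℂ A).roots.toFinset.finite_toSet).subset fun z hz => ?_
    simpa [minpoly.ne_zero (Matrix.isIntegral A)] using
      (mem_spectrum_iff_isRoot_minpoly A z).1 hz
  refine eq_of_infinite_eval_eq _ _ (hfin.infinite_compl.mono fun z hz => ?_)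
  have hz' : z ∉ spectrum ℂ A := hz
  have hχ := congrArg (eval z) (charpoly_eq_div_mul_minpoly A)
  rw [Set.mem_ofPred_eq, eval_mul, eval_sub, eval_mul, eval_C, puv_eval A u v z hz']
  rw [eval_mul] at hχ
  have hscalar : Matrix.scalar (Fin n) z = z • (1 : Matrix (Fin n) (Fin n) ℂ) := by
    rw [Matrix.smul_one_eq_diagonal]; rfl
  set N := z • (1 : Matrix (Fin n) (Fin n) ℂ) - A with hN
  have hNdet : IsUnit N.det := by
    rw [spectrum.notMem_iff, Algebra.algebraMap_eq_smul_one] at hz'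
    exact (Matrix.isUnit_iff_isUnit_det _).1 hz'
  rw [Matrix.eval_charpoly, hscalar, ← hN] at hχ
  have h1 : z • (1 : Matrix (Fin n) (Fin n) ℂ) - pert A u v τ
      = N + replicateCol Unit (-τ • u) * replicateRow Unit (star v) := by
    rw [← vecMulVec_eq, pert, hN, Matrix.smul_vecMulVec, neg_smul]
    abel
  rw [Matrix.eval_charpoly, hscalar, h1, Matrix.det_add_replicateCol_mul_replicateRow hNdet,
    Matrix.det_unique (n := Unit), hχ]
  have h2 : (1 + replicateRow Unit (star v) * N⁻¹ * replicateCol Unit (-τ • u) :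
      Matrix Unit Unit ℂ) default default
      = 1 - τ * (star v ⬝ᵥ (N⁻¹ *ᵥ u)) := by
    rw [Matrix.mul_assoc, Matrix.replicateCol_smul, Matrix.mul_smul, Matrix.mul_smul,
      ← Matrix.replicateCol_mulVec, Matrix.add_apply, Matrix.smul_apply,
      Matrix.replicateRow_mul_replicateCol_apply, Matrix.one_apply_eq]
    simp [sub_eq_add_neg]
  rw [h2, Matrix.smul_mulVec, dotProduct_smul, smul_eq_mul]
  ring

/-! ### The branches of moving eigenvalues -/

/-- If finitely many continuous functions list the values of a finite family of continuous
functions on a preconnected set, the latter having distinct values at each point, then the lists agree up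
to a permutation. -/
theorem exists_perm_of_range_eq {l : ℕ} {lam mu : Fin l → ℝ → ℂ} {T : Set ℝ}
    (hT : IsPreconnected T) (hne : T.Nonempty) (hlam : ∀ i, ContinuousOn (lam i) T)
    (hmu : ∀ i, ContinuousOn (mu i) T) (hinj : ∀ τ ∈ T, Function.Injective fun i => lam i τ)
    (hrange : ∀ τ ∈ T, (Set.range fun i => mu i τ) = Set.range fun i => lam i τ) :
    ∃ s : Equiv.Perm (Fin l), ∀ j, ∀ τ ∈ T, mu j τ = lam (s j) τ := by
  have : PreconnectedSpace T := Subtype.preconnectedSpace hT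
  obtain ⟨τ₀, hτ₀⟩ := hne
  have key : ∀ j, ∃ i, ∀ τ ∈ T, mu j τ = lam i τ := by
    intro j
    have hex : ∀ τ ∈ T, ∃ i, mu j τ = lam i τ := fun τ hτ => by
      obtain ⟨i, hi⟩ := (hrange τ hτ).subset ⟨j, rfl⟩
      exact ⟨i, hi.symm⟩
    have hclosed : ∀ i, IsClosed {τ : T | mu j τ = lam i τ} := fun i =>
      isClosed_eq (hmu j).domRestrict (hlam i).domRestrict
    obtain ⟨i, hi⟩ := hex τ₀ hτ₀
    have hopen : IsOpen {τ : T | mu j τ = lam i τ} := by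
      have h : {τ : T | mu j τ = lam i τ}ᶜ = ⋃ k : {k // k ≠ i}, {τ : T | mu j τ = lam k τ} := by
        ext τ
        simp only [Set.mem_compl_iff, Set.mem_ofPred_eq, Set.mem_iUnion, Subtype.exists,
          exists_prop]
        refine ⟨fun h => ?_, fun ⟨k, hk, h⟩ h' => hk (hinj τ τ.2 (h.symm.trans h'))⟩
        obtain ⟨k, hk⟩ := hex τ τ.2
        exact ⟨k, fun hki => h (hki ▸ hk), hk⟩
      rw [← isClosed_compl_iff, h]
      exact isClosed_iUnion_of_finite fun k => hclosed k
    have huniv := IsClopen.eq_univ ⟨hclosed i, hopen⟩ ⟨⟨τ₀, hτ₀⟩, hi⟩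
    exact ⟨i, fun τ hτ => by simpa using huniv.ge (Set.mem_univ (⟨τ, hτ⟩ : T))⟩
  choose s hs using key
  have hsurj : Function.Surjective s := fun i => by
    obtain ⟨j, hj⟩ := (hrange τ₀ hτ₀).symm.subset ⟨i, rfl⟩
    exact ⟨j, hinj τ₀ hτ₀ ((hs j τ₀ hτ₀).symm.trans hj)⟩
  exact ⟨Equiv.ofBijective s ⟨Finite.injective_iff_surjective.2 hsurj, hsurj⟩, hs⟩

/-- The moving eigenvalues form global analytic branches as soon as `m_A` and `p_{uv}` have no
common zero and `m_A / p_{uv}` has no positive critical value. -/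
theorem exists_globalBranches {n : ℕ} (A : Matrix (Fin n) (Fin n) ℂ) (u v : Fin n → ℂ)
    (hcop : ∀ z, ¬ AccidentallyFrozen A u v z)
    (hcrit : ∀ z, (derivative (minpoly ℂ A) * puv A u v
        - minpoly ℂ A * derivative (puv A u v)).IsRoot z →
      ∀ τ : ℝ, 0 < τ → (minpoly ℂ A).eval z ≠ τ * (puv A u v).eval z) :
    ∃ lam : Fin (minpoly ℂ A).natDegree → ℝ → ℂ, GlobalBranches A u v lam := by
  have hm : (minpoly ℂ A).Monic := minpoly.monic (Matrix.isIntegral A)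
  have hdeg := degree_puv_lt A u v
  have hχ := charpoly_eq_div_mul_minpoly A
  have hχτ := charpoly_pert A u v
  have hspec := mem_spectrum_iff_isRoot_minpoly A
  have hQ : ∀ z, (A.charpoly / minpoly ℂ A).IsRoot z → (minpoly ℂ A).IsRoot z := fun z hz => by
    rw [← hspec, Matrix.mem_spectrum_iff_isRoot_charpoly]
    exact hz.dvd ⟨_, hχ⟩
  obtain ⟨U, g, hU, hUpos, hg, hgs⟩ : ∃ (U : Set ℂ) (g : Fin (minpoly ℂ A).natDegree → ℂ → ℂ),
      IsOpen U ∧ (∀ τ : ℝ, 0 < τ → (τ : ℂ) ∈ U) ∧ (∀ j, AnalyticOnNhd ℂ (g j) U) ∧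
      ∀ s ∈ U, Function.Injective (fun j => g j s) ∧
        ∀ j, (minpoly ℂ A).eval (g j s) = s * (puv A u v).eval (g j s) := by
    rcases Nat.eq_zero_or_pos (minpoly ℂ A).natDegree with h0 | h0
    · have : IsEmpty (Fin (minpoly ℂ A).natDegree) := by rw [h0]; exact Fin.isEmpty
      exact ⟨Set.univ, isEmptyElim, isOpen_univ, fun _ _ => trivial, isEmptyElim,
        fun _ _ => ⟨fun i => isEmptyElim i, isEmptyElim⟩⟩
    · refine exists_analytic_branches hm ?_ hcop hcrit
      rcases eq_or_ne (puv A u v) 0 with hp0 | hp0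
      · rwa [hp0, natDegree_zero]
      · exact natDegree_lt_natDegree hp0 hdeg
  have hroots : ∀ s ∈ U, ∀ z, (minpoly ℂ A).eval z = s * (puv A u v).eval z → ∃ j, g j s = z := by
    intro s hs z hz
    have hdeg' : (C s * puv A u v).degree < (minpoly ℂ A).degree := by
      rw [C_mul']
      exact (degree_smul_le _ _).trans_lt hdeg
    have hf0 : minpoly ℂ A - C s * puv A u v ≠ 0 := (hm.sub_of_left hdeg').ne_zero
    have hsub : Finset.univ.image (fun j => g j s)
        ⊆ (minpoly ℂ A - C s * puv A u v).roots.toFinset := by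
      intro w hw
      obtain ⟨j, -, rfl⟩ := Finset.mem_image.1 hw
      simp [hf0, (hgs s hs).2 j]
    have heq := Finset.eq_of_subset_of_card_le hsub (by
      rw [Finset.card_image_of_injective _ (hgs s hs).1, Finset.card_univ, Fintype.card_fin]
      refine (Multiset.toFinset_card_le _).trans ((card_roots' _).trans ?_)
      exact (natDegree_eq_of_degree_eq (degree_sub_eq_left_of_degree_lt hdeg')).le)
    have hzmem : z ∈ (minpoly ℂ A - C s * puv A u v).roots.toFinset := by
      simp [hf0, hz]
    rw [← heq] at hzmem
    obtain ⟨j, -, hj⟩ := Finset.mem_image.1 hzmem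
    exact ⟨j, hj⟩
  have hmg : ∀ j, ∀ τ : ℝ, 0 < τ → (minpoly ℂ A).eval (g j τ) ≠ 0 := by
    intro j τ hτ h
    have h1 := (hgs τ (hUpos τ hτ)).2 j
    rw [h, zero_eq_mul] at h1
    exact hcop _ ⟨h, h1.resolve_left (by exact_mod_cast hτ.ne')⟩
  have hlists : ListsMovingEigenvalues A u v fun j τ => g j τ := by
    intro τ hτ
    ext z
    rw [Set.mem_sdiff, hspec, Matrix.mem_spectrum_iff_isRoot_charpoly, hχτ, root_mul]
    constructor
    · rintro ⟨hz | hz, hz'⟩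
      · exact absurd (hQ z hz) hz'
      · exact hroots τ (hUpos τ hτ) z (by simpa [sub_eq_zero] using hz)
    · rintro ⟨j, rfl⟩
      exact ⟨Or.inr (by simp [(hgs τ (hUpos τ hτ)).2 j]), hmg j τ hτ⟩
  have hcont : ∀ j, ContinuousOn (fun τ : ℝ => g j τ) (Set.Ioi 0) := fun j =>
    (hg j).continuousOn.comp Complex.continuous_ofReal.continuousOn fun τ hτ => hUpos τ hτ
  refine ⟨fun j τ => g j τ, hlists, fun j τ hτ => ?_, fun mu hmu hmul => ?_, fun τ hτ z hz hzA => ?_,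
    hcop, fun i j hij τ τ' hτ hτ' h => ?_, U, hU, hUpos, fun j => ⟨g j, hg j, fun _ _ => rfl⟩⟩
  · have hne := (Matrix.charpoly_monic (pert A u v τ)).ne_zero
    have hroot : (minpoly ℂ A - C (τ : ℂ) * puv A u v).IsRoot (g j τ) := by
      simp [(hgs τ (hUpos τ hτ)).2 j]
    rw [hχτ] at hne ⊢
    rw [rootMultiplicity_mul hne, rootMultiplicity_eq_zero fun h => hmg j τ hτ (hQ _ h), zero_add]
    have hne' := right_ne_zero_of_mul hne
    refine le_antisymm (not_lt.1 fun h => ?_) ((rootMultiplicity_pos hne').2 hroot)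
    have hder := ((one_lt_rootMultiplicity_iff_isRoot hne').1 h).2
    simp only [IsRoot.def, derivative_sub, derivative_C_mul, eval_sub, eval_mul, eval_C]
      at hroot hder
    refine hcrit (g j τ) ?_ τ hτ (sub_eq_zero.1 hroot)
    simp only [IsRoot.def, eval_sub, eval_mul]
    linear_combination (puv A u v).eval (g j τ) * hder
      - (derivative (puv A u v)).eval (g j τ) * hroot
  · exact exists_perm_of_range_eq isPreconnected_Ioi ⟨1, Set.mem_Ioi.2 one_pos⟩ hcont hmu
      (fun τ hτ => (hgs τ (hUpos τ hτ)).1) fun τ hτ => (hmul τ hτ).symm.trans (hlists τ hτ)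
  · rw [hspec] at hzA
    rw [Matrix.mem_spectrum_iff_isRoot_charpoly, hχτ, root_mul] at hz
    refine hz.resolve_right fun h => hcop z ⟨hzA, ?_⟩
    simp only [IsRoot.def, eval_sub, eval_mul, eval_C] at h hzA
    rw [hzA, zero_sub, neg_eq_zero, mul_eq_zero] at h
    exact h.resolve_left (by exact_mod_cast hτ.ne')
  · have h1 := (hgs τ (hUpos τ hτ)).2 i
    have h2 := (hgs τ' (hUpos τ' hτ')).2 j
    -- a common value of two branches determines the parameter as the value of `m_A / p_{uv}`
    change g i τ = g j τ' at h
    rw [← h, h1] at h2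
    have hp : (puv A u v).eval (g i τ) ≠ 0 := fun h0 => hmg i τ hτ (by rw [h1, h0, mul_zero])
    have hττ' : (τ : ℂ) = τ' := mul_right_cancel₀ hp h2
    rw [← hττ'] at h
    exact hij ((hgs τ (hUpos τ hτ)).1 h)

/-! ### Vectors with full minimal polynomial -/

theorem aeval_ne_zero_of_natDegree_lt {n : ℕ} {A : Matrix (Fin n) (Fin n) ℂ} {q : ℂ[X]}
    (hq : q ≠ 0) (hdeg : q.natDegree < (minpoly ℂ A).natDegree) : aeval A q ≠ 0 := fun h =>
  absurd (natDegree_le_of_dvd (minpoly.dvd ℂ A h) hq) (not_le.2 hdeg)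

/-- A vector is not admissible exactly if it is annihilated by one of the maximal proper divisors
`m_A / (X - z)` of the minimal polynomial. -/
theorem not_fullMinpolyVector_iff {n : ℕ} (A : Matrix (Fin n) (Fin n) ℂ) (u : Fin n → ℂ) :
    ¬ FullMinpolyVector A u ↔ ∃ z ∈ (minpoly ℂ A).roots.toFinset,
      aeval A (minpoly ℂ A /ₘ (X - C z)) *ᵥ u = 0 := by
  have hm : (minpoly ℂ A).Monic := minpoly.monic (Matrix.isIntegral A)
  have hdiv : ∀ z ∈ (minpoly ℂ A).roots.toFinset,
      (X - C z) * (minpoly ℂ A /ₘ (X - C z)) = minpoly ℂ A := fun z hz =>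
    mul_divByMonic_eq_iff_isRoot.2 ((mem_roots hm.ne_zero).1 (Multiset.mem_toFinset.1 hz))
  constructor
  · intro h
    rw [FullMinpolyVector] at h
    push Not at h
    obtain ⟨q, hqu, hq⟩ := h
    set d := EuclideanDomain.gcd q (minpoly ℂ A) with hd
    have hdu : aeval A d *ᵥ u = 0 := by
      rw [hd, EuclideanDomain.gcd_eq_gcd_ab, map_add, mul_comm q, map_mul, map_mul, minpoly.aeval,
        zero_mul, add_zero, ← Matrix.mulVec_mulVec, hqu, Matrix.mulVec_zero]
    obtain ⟨e, he⟩ : d ∣ minpoly ℂ A := EuclideanDomain.gcd_dvd_right _ _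
    have hem : e.degree ≠ 0 := by
      intro h0
      have hunit := isUnit_iff_degree_eq_zero.2 h0
      refine hq (minpoly.dvd_iff.1 ?_)
      rw [he]
      exact (hunit.mul_right_dvd).2 (EuclideanDomain.gcd_dvd_left _ _)
    obtain ⟨z, hz⟩ := IsAlgClosed.exists_root e hem
    have hzm : z ∈ (minpoly ℂ A).roots.toFinset :=
      Multiset.mem_toFinset.2 ((mem_roots hm.ne_zero).2 (hz.dvd ⟨d, by rw [he, mul_comm]⟩))
    refine ⟨z, hzm, ?_⟩
    obtain ⟨e', he'⟩ := dvd_iff_isRoot.2 hz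
    have : minpoly ℂ A /ₘ (X - C z) = e' * d := by
      refine mul_left_cancel₀ (X_sub_C_ne_zero z) ?_
      rw [hdiv z hzm]
      conv_lhs => rw [he, he']
      ring
    rw [this, map_mul, ← Matrix.mulVec_mulVec, hdu, Matrix.mulVec_zero]
  · rintro ⟨z, hz, hzu⟩ hu
    have h0 := hu _ hzu
    have hne : minpoly ℂ A /ₘ (X - C z) ≠ 0 := fun h => hm.ne_zero (by rw [← hdiv z hz, h, mul_zero])
    refine aeval_ne_zero_of_natDegree_lt hne ?_ h0
    conv_rhs => rw [← hdiv z hz]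
    rw [natDegree_mul (X_sub_C_ne_zero z) hne, natDegree_X_sub_C]
    omega

theorem isClosed_not_fullMinpolyVector {n : ℕ} (A : Matrix (Fin n) (Fin n) ℂ) :
    IsClosed {u : Fin n → ℂ | ¬ FullMinpolyVector A u} := by
  simp only [not_fullMinpolyVector_iff]
  have : {u : Fin n → ℂ | ∃ z ∈ (minpoly ℂ A).roots.toFinset,
      aeval A (minpoly ℂ A /ₘ (X - C z)) *ᵥ u = 0} = ⋃ z ∈ (minpoly ℂ A).roots.toFinset,
      {u : Fin n → ℂ | aeval A (minpoly ℂ A /ₘ (X - C z)) *ᵥ u = 0} := by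
    ext u; simp
  rw [this]
  exact isClosed_biUnion_finset fun z _ =>
    isClosed_eq (Continuous.matrix_mulVec continuous_const continuous_id) continuous_const

theorem interior_not_fullMinpolyVector {n : ℕ} (A : Matrix (Fin n) (Fin n) ℂ) :
    interior {u : Fin n → ℂ | ¬ FullMinpolyVector A u} = ∅ := by
  have hm : (minpoly ℂ A).Monic := minpoly.monic (Matrix.isIntegral A)
  have heq : {u : Fin n → ℂ | ¬ FullMinpolyVector A u}ᶜ = ⋂ z ∈ (minpoly ℂ A).roots.toFinset,
      {u : Fin n → ℂ | aeval A (minpoly ℂ A /ₘ (X - C z)) *ᵥ u = 0}ᶜ := by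
    ext u
    simp only [not_fullMinpolyVector_iff]
    simp
  rw [interior_eq_empty_iff_dense_compl, heq]
  refine dense_biInter_of_isOpen (fun z _ => ?_)
    (minpoly ℂ A).roots.toFinset.finite_toSet.countable fun z hz => ?_
  · exact (isClosed_eq (Continuous.matrix_mulVec continuous_const continuous_id)
      continuous_const).isOpen_compl
  · rw [← interior_eq_empty_iff_dense_compl, ← Set.not_nonempty_iff_eq_empty]
    intro hne
    have htop := (LinearMap.ker (Matrix.mulVecLin
      (aeval A (minpoly ℂ A /ₘ (X - C z))))).eq_top_of_nonempty_interior' hne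
    rw [LinearMap.ker_eq_top] at htop
    have h0 : aeval A (minpoly ℂ A /ₘ (X - C z)) = 0 :=
      Matrix.mulVec_injective (funext fun x => by simpa using LinearMap.congr_fun htop x)
    have hdiv : (X - C z) * (minpoly ℂ A /ₘ (X - C z)) = minpoly ℂ A :=
      mul_divByMonic_eq_iff_isRoot.2 ((mem_roots hm.ne_zero).1 (Multiset.mem_toFinset.1 hz))
    have hne' : minpoly ℂ A /ₘ (X - C z) ≠ 0 := fun h => hm.ne_zero (by rw [← hdiv, h, mul_zero])
    refine aeval_ne_zero_of_natDegree_lt hne' ?_ h0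
    conv_rhs => rw [← hdiv]
    rw [natDegree_mul (X_sub_C_ne_zero z) hne', natDegree_X_sub_C]
    omega

/-! ### The polynomial `p_{uv}` as a function of the vectors -/

theorem puv_add {n : ℕ} (A : Matrix (Fin n) (Fin n) ℂ) (u v w : Fin n → ℂ) :
    puv A u (v + w) = puv A u v + puv A u w := by
  simp only [puv, star_add, add_dotProduct, mul_add, map_add, add_mul, Finset.sum_add_distrib]

theorem puv_smul {n : ℕ} (A : Matrix (Fin n) (Fin n) ℂ) (u v : Fin n → ℂ) (c : ℂ) :
    puv A u (c • v) = C (star c) * puv A u v := by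
  simp only [puv, star_smul, smul_dotProduct, smul_eq_mul, Finset.mul_sum, ← mul_assoc, ← C_mul]
  refine Finset.sum_congr rfl fun k _ => Finset.sum_congr rfl fun i _ => ?_
  rw [mul_right_comm, mul_comm _ (star c), mul_assoc (star c)]

theorem natDegree_puv_le {n : ℕ} (A : Matrix (Fin n) (Fin n) ℂ) (u v : Fin n → ℂ) :
    (puv A u v).natDegree ≤ (minpoly ℂ A).natDegree - 1 := by
  rcases eq_or_ne (puv A u v) 0 with h | h
  · simp [h]
  · exact Nat.le_sub_one_of_lt (natDegree_lt_natDegree h (degree_puv_lt A u v))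

theorem continuous_coeff_puv {n : ℕ} (A : Matrix (Fin n) (Fin n) ℂ) (i : ℕ) :
    Continuous fun w : (Fin n → ℂ) × (Fin n → ℂ) => (puv A w.1 w.2).coeff i := by
  simp only [coeff_puv]
  refine continuous_finsetSum _ fun k _ => ?_
  split_ifs
  · exact continuous_const.mul (Continuous.dotProduct (continuous_star.comp continuous_snd)
      (Continuous.matrix_mulVec continuous_const continuous_fst))
  · exact continuous_const

theorem coeff_puv_top {n : ℕ} (A : Matrix (Fin n) (Fin n) ℂ) (u v : Fin n → ℂ)
    (hl : 0 < (minpoly ℂ A).natDegree) :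
    (puv A u v).coeff ((minpoly ℂ A).natDegree - 1) = star v ⬝ᵥ u := by
  rw [coeff_puv, Finset.sum_range_succ, Finset.sum_eq_zero, if_pos (by omega), Nat.sub_self,
    (minpoly.monic (Matrix.isIntegral A)).coeff_natDegree]
  · simp
  · intro k hk
    rw [Finset.mem_range] at hk
    exact if_neg (by omega)

/-- For admissible `u` the Krylov vectors `u, A u, …, A^(l-1) u` are linearly independent, so there
is a functional that vanishes on all of them but the last; its polynomial is constant. -/
theorem FullMinpolyVector.exists_puv_eq_one {n : ℕ} {A : Matrix (Fin n) (Fin n) ℂ}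
    {u : Fin n → ℂ} (hu : FullMinpolyVector A u) (hl : 0 < (minpoly ℂ A).natDegree) :
    ∃ w : Fin n → ℂ, puv A u w = 1 := by
  have hm : (minpoly ℂ A).Monic := minpoly.monic (Matrix.isIntegral A)
  set l := (minpoly ℂ A).natDegree with hldef
  have hnot : A ^ (l - 1) *ᵥ u ∉
      Submodule.span ℂ (Set.range fun j : Fin (l - 1) => A ^ (j : ℕ) *ᵥ u) := by
    intro h
    obtain ⟨c, hc⟩ := (Submodule.mem_span_range_iff_exists_fun ℂ).1 h
    have hdeg : (∑ j : Fin (l - 1), C (c j) * X ^ (j : ℕ)).degree < (X ^ (l - 1) : ℂ[X]).degree := by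
      rw [degree_X_pow]
      exact degree_sum_fin_lt c
    have hq : aeval A (X ^ (l - 1) - ∑ j : Fin (l - 1), C (c j) * X ^ (j : ℕ)) *ᵥ u = 0 := by
      simp only [map_sub, map_sum, map_mul, map_pow, aeval_X, aeval_C,
        Algebra.algebraMap_eq_smul_one, smul_mul_assoc, one_mul, Matrix.sub_mulVec,
        Matrix.sum_mulVec, Matrix.smul_mulVec, hc, sub_self]
    refine aeval_ne_zero_of_natDegree_lt ((monic_X_pow _).sub_of_left hdeg).ne_zero ?_ (hu _ hq)
    rw [natDegree_eq_of_degree_eq (degree_sub_eq_left_of_degree_lt hdeg), natDegree_X_pow]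
    omega
  obtain ⟨f, hf, hfker⟩ := Submodule.exists_le_ker_of_notMem hnot
  set a := f (A ^ (l - 1) *ᵥ u) with ha
  have hfd : ∀ x, (fun i => f (Pi.single i 1)) ⬝ᵥ x = f x := fun x => by
    rw [LinearMap.pi_apply_eq_sum_univ f x, dotProduct]
    refine Finset.sum_congr rfl fun i _ => ?_
    rw [smul_eq_mul, mul_comm]
    congr 2
    ext j
    simp [Pi.single_apply, eq_comm]
  refine ⟨star (a⁻¹ • fun i => f (Pi.single i 1)), ?_⟩
  have hlow : ∀ j < l - 1, f (A ^ j *ᵥ u) = 0 := fun j hj =>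
    hfker (Submodule.subset_span ⟨⟨j, hj⟩, rfl⟩)
  ext i
  rw [coeff_puv, star_star, Finset.sum_range_succ, Finset.sum_eq_zero, zero_add, ← hldef,
    hldef, hm.coeff_natDegree, ← hldef, one_mul, smul_dotProduct, hfd, smul_eq_mul, coeff_one]
  · rcases Nat.eq_zero_or_pos i with rfl | hi
    · rw [if_pos hl, if_pos rfl, Nat.sub_zero, ← ha, inv_mul_cancel₀ hf]
    · rw [if_neg (by omega : ¬ i = 0)]
      split_ifs with h
      · rw [hlow _ (by omega), mul_zero]
      · rfl
  · intro k hk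
    rw [Finset.mem_range] at hk
    split_ifs with h
    · rw [smul_dotProduct, hfd, hlow _ (by omega), smul_zero, mul_zero]
    · rfl

/-! ### The reduced Wronskian -/

/-- The logarithmic derivative `m' / m` in lowest terms is `N / M`, where `M` has the same roots as
`m` but is separable. -/
theorem exists_reduced_logDeriv {m : ℂ[X]} (hl : 0 < m.natDegree) :
    ∃ g M N : ℂ[X], m = g * M ∧ derivative m = g * N ∧
      (∀ z, m.IsRoot z → M.IsRoot z ∧ ¬ N.IsRoot z) ∧ 0 < M.natDegree ∧
      N.natDegree = M.natDegree - 1 ∧ N.leadingCoeff = m.natDegree * M.leadingCoeff := by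
  have hm0 : m ≠ 0 := by rintro rfl; simp at hl
  have hd0 : derivative m ≠ 0 := fun h => hl.ne' (derivative_eq_zero.1 h)
  set g := EuclideanDomain.gcd m (derivative m) with hg
  have hg0 : g ≠ 0 := fun h => hm0 (EuclideanDomain.gcd_eq_zero_iff.1 h).1
  obtain ⟨M, hM⟩ : g ∣ m := EuclideanDomain.gcd_dvd_left _ _
  obtain ⟨N, hN⟩ : g ∣ derivative m := EuclideanDomain.gcd_dvd_right _ _
  have hM0 : M ≠ 0 := fun h => hm0 (by rw [hM, h, mul_zero])
  have hN0 : N ≠ 0 := fun h => hd0 (by rw [hN, h, mul_zero])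
  have hco : IsCoprime M N := by
    refine ⟨EuclideanDomain.gcdA m (derivative m), EuclideanDomain.gcdB m (derivative m),
      mul_left_cancel₀ hg0 ?_⟩
    rw [mul_one]
    conv_rhs => rw [hg, EuclideanDomain.gcd_eq_gcd_ab]
    linear_combination -EuclideanDomain.gcdA m (derivative m) * hM
      - EuclideanDomain.gcdB m (derivative m) * hN
  have hdM : m.natDegree = g.natDegree + M.natDegree := by
    rw [← natDegree_mul hg0 hM0, ← hM]
  have hdN : m.natDegree - 1 = g.natDegree + N.natDegree := by
    rw [← natDegree_mul hg0 hN0, ← hN, natDegree_derivative]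
  refine ⟨g, M, N, hM, hN, fun z hz => ?_, by omega, by omega, ?_⟩
  · have hMz : M.IsRoot z := by
      have h1 := derivative_rootMultiplicity_of_root hz
      have h2 := (rootMultiplicity_pos hm0).2 hz
      have h3 : m.rootMultiplicity z = g.rootMultiplicity z + M.rootMultiplicity z := by
        rw [← rootMultiplicity_mul (mul_ne_zero hg0 hM0), ← hM]
      have h4 : (derivative m).rootMultiplicity z
          = g.rootMultiplicity z + N.rootMultiplicity z := by
        rw [← rootMultiplicity_mul (mul_ne_zero hg0 hN0), ← hN]
      exact (rootMultiplicity_pos hM0).1 (by omega)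
    refine ⟨hMz, fun hNz => ?_⟩
    obtain ⟨a, b, hab⟩ := hco
    have := congrArg (eval z) hab
    simp [hMz.eq_zero, hNz.eq_zero] at this
  · have h1 : m.leadingCoeff = g.leadingCoeff * M.leadingCoeff := by
      rw [← leadingCoeff_mul, ← hM]
    have h2 : (derivative m).leadingCoeff = g.leadingCoeff * N.leadingCoeff := by
      rw [← leadingCoeff_mul, ← hN]
    have h3 : (derivative m).leadingCoeff = m.leadingCoeff * m.natDegree := by
      rw [leadingCoeff, natDegree_derivative, coeff_derivative, Nat.sub_add_cancel hl,
        Nat.cast_sub hl]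
      simp
    refine mul_left_cancel₀ (leadingCoeff_ne_zero.2 hg0) ?_
    rw [← h2, h3, h1]
    ring

theorem coeff_X_mul_derivative (p : ℂ[X]) (k : ℕ) :
    (X * derivative p).coeff k = k * p.coeff k := by
  cases k with
  | zero => simp
  | succ k => rw [coeff_X_mul, coeff_derivative]; push_cast; ring

/-- The Wronskian `m' p - m p'` divided by `gcd (m, m')`, for `m' / m = N / M` in lowest terms. -/
noncomputable def reducedWronskian (M N p : ℂ[X]) : ℂ[X] := N * p - M * derivative p

/-- The top coefficient of the reduced Wronskian is that of `p` up to a constant, because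
`deg m` and `deg m - 1` do not cancel. -/
theorem coeff_reducedWronskian {M N p : ℂ[X]} {l : ℕ} (hl : 0 < l) (hM : 0 < M.natDegree)
    (hN : N.natDegree = M.natDegree - 1) (hlc : N.leadingCoeff = l * M.leadingCoeff)
    (hp : p.natDegree ≤ l - 1) :
    (reducedWronskian M N p).natDegree ≤ M.natDegree - 1 + (l - 1) ∧
      (reducedWronskian M N p).coeff (M.natDegree - 1 + (l - 1))
        = M.leadingCoeff * p.coeff (l - 1) := by
  have hX : (X * derivative p).natDegree ≤ l - 1 := by
    rw [natDegree_le_iff_coeff_eq_zero]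
    intro k hk
    rw [coeff_X_mul_derivative, coeff_eq_zero_of_natDegree_lt (hp.trans_lt hk), mul_zero]
  have hshift : ∀ k, (M * derivative p).coeff k = (M * (X * derivative p)).coeff (k + 1) :=
    fun k => by rw [mul_left_comm, coeff_X_mul]
  constructor
  · refine (natDegree_sub_le _ _).trans (max_le ?_ ?_)
    · exact natDegree_mul_le.trans (by omega)
    · rw [natDegree_le_iff_coeff_eq_zero]
      intro k hk
      rw [hshift]
      exact coeff_eq_zero_of_natDegree_lt (natDegree_mul_le.trans_lt (by omega))
  · rw [reducedWronskian, coeff_sub, hshift, coeff_mul_add_eq_of_natDegree_le hN.le hp,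
      show M.natDegree - 1 + (l - 1) + 1 = M.natDegree + (l - 1) by omega,
      coeff_mul_add_eq_of_natDegree_le le_rfl hX, coeff_X_mul_derivative, ← hN, coeff_natDegree,
      coeff_natDegree, hlc, Nat.cast_sub hl]
    push_cast
    ring

/-! ### The exceptional set -/

section Generic

/-- The pairs of vectors to be avoided, where `m_A' / m_A = N / M` in lowest terms: those for which
`p_{uv}` drops degree or has a zero in common with `m_A`, or for which `m_A * conj p_{uv}` takes a
nonnegative real value at a root of the reduced Wronskian. At such a root, if `p_{uv}` does not
vanish, this says that the critical value `m_A / p_{uv}` is nonnegative; the parasitic critical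
points, at the multiple zeros of `m_A`, are not roots of the reduced Wronskian. -/
def exceptionalPairs {n : ℕ} (A : Matrix (Fin n) (Fin n) ℂ) (M N : ℂ[X]) :
    Set ((Fin n → ℂ) × (Fin n → ℂ)) :=
  {w | (reducedWronskian M N (puv A w.1 w.2)).coeff
      (M.natDegree - 1 + ((minpoly ℂ A).natDegree - 1)) = 0 ∨
    ∃ z, (reducedWronskian M N (puv A w.1 w.2)).IsRoot z ∧
      (w, z) ∈ {x : ((Fin n → ℂ) × (Fin n → ℂ)) × ℂ |
        (minpoly ℂ A).eval x.2 * star ((puv A x.1.1 x.1.2).eval x.2) ∈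
          {c : ℂ | 0 ≤ c.re ∧ c.im = 0}}} ∪
  ⋃ z ∈ (minpoly ℂ A).roots.toFinset, {w | (puv A w.1 w.2).eval z = 0}

variable {n : ℕ} {A : Matrix (Fin n) (Fin n) ℂ} {g M N : ℂ[X]}

theorem isClosed_exceptionalPairs (hl : 0 < (minpoly ℂ A).natDegree) (hM : 0 < M.natDegree)
    (hN : N.natDegree = M.natDegree - 1)
    (hlc : N.leadingCoeff = (minpoly ℂ A).natDegree * M.leadingCoeff) :
    IsClosed (exceptionalPairs A M N) := by
  have hev := continuous_eval_of_continuous_coeff (continuous_coeff_puv A)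
    fun w => natDegree_puv_le A w.1 w.2
  refine IsClosed.union ?_ (isClosed_biUnion_finset fun z _ =>
    isClosed_eq
      (f := fun w : (Fin n → ℂ) × (Fin n → ℂ) => (puv A w.1 w.2).eval z)
      (hev.comp (Continuous.prodMk_left z)) continuous_const)
  refine isClosed_coeff_eq_zero_or_exists_isRoot
    (fun w : (Fin n → ℂ) × (Fin n → ℂ) => reducedWronskian M N (puv A w.1 w.2)) _ (fun i => ?_)
    (fun w => (coeff_reducedWronskian hl hM hN hlc (natDegree_puv_le A w.1 w.2)).1) _ ?_
  · simp only [reducedWronskian, coeff_sub, coeff_mul, coeff_derivative]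
    refine Continuous.sub (continuous_finsetSum _ fun k _ => ?_)
      (continuous_finsetSum _ fun k _ => ?_)
    · exact continuous_const.mul (continuous_coeff_puv A _)
    · exact continuous_const.mul ((continuous_coeff_puv A _).mul continuous_const)
  · have hclosed : IsClosed {c : ℂ | 0 ≤ c.re ∧ c.im = 0} :=
      (isClosed_le continuous_const Complex.continuous_re).inter
        (isClosed_eq Complex.continuous_im continuous_const)
    exact hclosed.preimage (((minpoly ℂ A).continuous.comp continuous_snd).mul
      (continuous_star.comp hev))

theorem exists_globalBranches_of_notMem_exceptionalPairs (hgM : minpoly ℂ A = g * M)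
    (hgN : derivative (minpoly ℂ A) = g * N) {u v : Fin n → ℂ}
    (huv : (u, v) ∉ exceptionalPairs A M N) :
    ∃ lam : Fin (minpoly ℂ A).natDegree → ℝ → ℂ, GlobalBranches A u v lam := by
  have hm : (minpoly ℂ A).Monic := minpoly.monic (Matrix.isIntegral A)
  rw [exceptionalPairs, Set.mem_union, not_or] at huv
  obtain ⟨h1, h2⟩ := huv
  have hcop : ∀ z, ¬ AccidentallyFrozen A u v z := fun z hz => h2 <| by
    simp only [Set.mem_iUnion]
    exact ⟨z, Multiset.mem_toFinset.2 ((mem_roots hm.ne_zero).2 hz.1), hz.2⟩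
  refine exists_globalBranches A u v hcop fun z hz τ hτ hτz => ?_
  have hW : (derivative (minpoly ℂ A) * puv A u v - minpoly ℂ A * derivative (puv A u v))
      = g * reducedWronskian M N (puv A u v) := by
    rw [hgN, reducedWronskian]
    conv_lhs => rw [hgM]
    ring
  rw [hW, root_mul] at hz
  rcases hz with hz | hz
  · have hmz : (minpoly ℂ A).IsRoot z := hz.dvd ⟨M, hgM⟩
    rw [hmz.eq_zero, zero_eq_mul] at hτz
    exact hcop z ⟨hmz, hτz.resolve_left (by exact_mod_cast hτ.ne')⟩
  · refine h1 (Or.inr ⟨z, hz, ?_⟩)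
    have : (minpoly ℂ A).eval z * star ((puv A u v).eval z)
        = ((τ * Complex.normSq ((puv A u v).eval z) : ℝ) : ℂ) := by
      rw [hτz, mul_assoc]
      simp [Complex.mul_conj]
    simp only [Set.mem_ofPred_eq]
    rw [this]
    exact ⟨by simpa using mul_nonneg hτ.le (Complex.normSq_nonneg _), Complex.ofReal_im _⟩

/-! ### Genericity -/

theorem finite_setOf_add_mul_eq_zero {a b : ℂ} (h : a ≠ 0 ∨ b ≠ 0) :
    {t : ℝ | a + t * b = 0}.Finite := by
  refine Set.Subsingleton.finite fun t ht t' ht' => ?_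
  simp only [Set.mem_ofPred_eq] at ht ht'
  have hb : b ≠ 0 := fun hb => h.elim (fun ha => ha (by simpa [hb] using ht)) fun h => h hb
  exact_mod_cast mul_right_cancel₀ hb (show (t : ℂ) * b = t' * b by linear_combination ht - ht')

theorem exists_add_smul_mem_of_finite {O : Set (Fin n → ℂ)} (hO : IsOpen O) {v : Fin n → ℂ}
    (hv : v ∈ O) (w : Fin n → ℂ) {S : Set ℝ} (hS : S.Finite) :
    ∃ t : ℝ, t ∉ S ∧ v + (t : ℂ) • w ∈ O := by
  have hcont : Continuous fun t : ℝ => v + (t : ℂ) • w := by fun_prop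
  have hmem : (fun t : ℝ => v + (t : ℂ) • w) ⁻¹' O ∈ nhds (0 : ℝ) :=
    (hO.preimage hcont).mem_nhds (by simpa using hv)
  obtain ⟨t, ht, htS⟩ := (infinite_of_mem_nhds 0 hmem).exists_notMem_finite hS
  exact ⟨t, htS, ht⟩

theorem puv_add_ofReal_smul (u v w : Fin n → ℂ) (t : ℝ) :
    puv A u (v + (t : ℂ) • w) = puv A u v + C (t : ℂ) * puv A u w := by
  rw [puv_add, puv_smul]
  simp

open scoped ComplexOrder in
/-- Every open set contains a vector `v` for which `p_{uv}` has full degree and simple zeros, none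
of them a zero of `m_A`: it suffices to move `v` along `u`, which changes the top coefficient, and
then to add a constant to `p_{uv}`. -/
theorem FullMinpolyVector.exists_mem_simple {u : Fin n → ℂ} (hu : FullMinpolyVector A u)
    (hl : 0 < (minpoly ℂ A).natDegree) {O : Set (Fin n → ℂ)} (hO : IsOpen O) (hne : O.Nonempty) :
    ∃ v ∈ O, (puv A u v).coeff ((minpoly ℂ A).natDegree - 1) ≠ 0 ∧
      (∀ z, (minpoly ℂ A).IsRoot z → (puv A u v).eval z ≠ 0) ∧
      ∀ z, (derivative (puv A u v)).eval z = 0 → (puv A u v).eval z ≠ 0 := by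
  have hm : (minpoly ℂ A).Monic := minpoly.monic (Matrix.isIntegral A)
  obtain ⟨v, hv⟩ := hne
  have hu0 : star u ⬝ᵥ u ≠ 0 := by
    rw [Ne, dotProduct_star_self_eq_zero]
    rintro rfl
    exact aeval_ne_zero_of_natDegree_lt (A := A) one_ne_zero (by simpa using hl)
      (hu 1 (Matrix.mulVec_zero _))
  obtain ⟨t, ht, htO⟩ := exists_add_smul_mem_of_finite hO hv u
    (finite_setOf_add_mul_eq_zero (a := star v ⬝ᵥ u) (Or.inr hu0))
  set v₁ := v + (t : ℂ) • u with hv₁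
  have hc₁ : (puv A u v₁).coeff ((minpoly ℂ A).natDegree - 1) ≠ 0 := by
    rwa [hv₁, puv_add_ofReal_smul, coeff_add, coeff_C_mul, coeff_puv_top A u v hl,
      coeff_puv_top A u u hl]
  obtain ⟨w, hw⟩ := hu.exists_puv_eq_one hl
  set p := puv A u v₁ with hp
  have hbad : ∀ z : ℂ, {s : ℝ | p.eval z + s * 1 = 0}.Finite := fun z =>
    finite_setOf_add_mul_eq_zero (Or.inr one_ne_zero)
  -- the constant `s` must differ from the values of `-p` at the zeros of `m_A` and of `p'`; the value
  -- at `0` is avoided as well, which covers the case that `p` is constant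
  obtain ⟨s, hs, hsO⟩ := exists_add_smul_mem_of_finite hO htO w
    (((Set.Finite.biUnion ((minpoly ℂ A).roots.toFinset.finite_toSet) fun z _ => hbad z).union
      (Set.Finite.biUnion ((derivative p).roots.toFinset.finite_toSet) fun z _ => hbad z)).union
      (hbad 0))
  simp only [Set.mem_union, Set.mem_iUnion, not_or, not_exists, Set.mem_ofPred_eq, mul_one] at hs
  obtain ⟨⟨hs1, hs2⟩, hs3⟩ := hs
  have hp₂ : puv A u (v₁ + (s : ℂ) • w) = p + C (s : ℂ) := by
    rw [puv_add_ofReal_smul, hw, mul_one]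
  refine ⟨_, hsO, ?_, fun z hz => ?_, fun z hz => ?_⟩ <;> rw [hp₂] at *
  · rw [coeff_add, coeff_C]
    split_ifs with h0
    · rw [h0, coeff_zero_eq_eval_zero]
      exact hs3
    · rwa [add_zero]
  · rw [eval_add, eval_C]
    exact hs1 z (by simpa [hm.ne_zero] using hz)
  · rw [eval_add, eval_C]
    rw [derivative_add, derivative_C, add_zero] at hz
    rcases eq_or_ne (derivative p) 0 with h0 | h0
    · rw [eq_C_of_derivative_eq_zero h0] at hs3 ⊢
      simpa using hs3
    · exact hs2 z (by simpa [h0] using hz)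

/-- Multiplying `v` by `1 + i t` rotates all critical values of `m_A / p_{uv}` while it fixes the
critical points. Since these are finite in number and the critical values neither zero nor infinite,
almost every `t` moves all of them off the real line. -/
theorem FullMinpolyVector.interior_exceptionalPairs {u : Fin n → ℂ} (hu : FullMinpolyVector A u)
    (hl : 0 < (minpoly ℂ A).natDegree)
    (hroot : ∀ z, (minpoly ℂ A).IsRoot z → M.IsRoot z ∧ ¬ N.IsRoot z)
    (hgM : minpoly ℂ A = g * M) (hM : 0 < M.natDegree)
    (hN : N.natDegree = M.natDegree - 1)
    (hlc : N.leadingCoeff = (minpoly ℂ A).natDegree * M.leadingCoeff) :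
    interior {v | (u, v) ∈ exceptionalPairs A M N} = ∅ := by
  rw [← Set.not_nonempty_iff_eq_empty]
  intro hne
  obtain ⟨v, hv, hc, hmp, hsimple⟩ := hu.exists_mem_simple hl isOpen_interior hne
  set p := puv A u v with hp
  set q := reducedWronskian M N p with hq
  have hM0 : M.leadingCoeff ≠ 0 := leadingCoeff_ne_zero.2 (by rintro rfl; simp at hM)
  have hq0 : q ≠ 0 := by
    have h := (coeff_reducedWronskian hl hM hN hlc (natDegree_puv_le A u v)).2
    rw [← hp, ← hq] at h
    intro h0
    rw [h0, coeff_zero] at h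
    exact mul_ne_zero hM0 hc h.symm
  set W : ℂ → ℂ := fun z => (minpoly ℂ A).eval z * star (p.eval z) with hW
  have hW0 : ∀ z, q.IsRoot z → W z ≠ 0 := by
    intro z hz
    simp only [hq, reducedWronskian, IsRoot.def, eval_sub, eval_mul] at hz
    have hmz : (minpoly ℂ A).eval z ≠ 0 := fun h => by
      have h1 := hroot z h
      rw [h1.1.eq_zero, zero_mul, sub_zero, mul_eq_zero] at hz
      exact hz.elim h1.2 (hmp z h)
    refine mul_ne_zero hmz (star_ne_zero.2 fun h => ?_)
    rw [h, mul_zero, zero_sub, neg_eq_zero, mul_eq_zero] at hz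
    rcases hz with hz | hz
    · exact hmz (by rw [hgM, eval_mul, hz, mul_zero])
    · exact hsimple z hz h
  obtain ⟨t, ht, htO⟩ := exists_add_smul_mem_of_finite isOpen_interior hv (Complex.I • v)
    (Set.Finite.biUnion (q.roots.toFinset.finite_toSet) fun z hz =>
      finite_setOf_add_mul_eq_zero (a := (W z).im) (b := (W z).re) (by
        have h := hW0 z (by simpa [hq0] using hz)
        by_contra! h'
        exact h (Complex.ext (by exact_mod_cast h'.2) (by exact_mod_cast h'.1))))
  simp only [Set.mem_iUnion, not_exists, Set.mem_ofPred_eq] at ht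
  have hc0 : (1 - t * Complex.I : ℂ) ≠ 0 := fun h => by
    have := congrArg Complex.re h
    simp at this
  have hp' : puv A u (v + (t : ℂ) • Complex.I • v) = C (1 - t * Complex.I) * p := by
    rw [puv_add_ofReal_smul, puv_smul, ← hp, map_sub, map_mul, map_one]
    simp
    ring
  have hq' : reducedWronskian M N (C (1 - t * Complex.I) * p) = C (1 - t * Complex.I) * q := by
    rw [hq, reducedWronskian, reducedWronskian, derivative_C_mul]
    ring
  rcases interior_subset htO with (h | ⟨z, hz, hK⟩) | h
  · rw [hp', hq', coeff_C_mul, (coeff_reducedWronskian hl hM hN hlc (natDegree_puv_le A u v)).2]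
      at h
    exact mul_ne_zero hc0 (mul_ne_zero hM0 hc) h
  · rw [hp', hq', root_mul] at hz
    have hqz : q.IsRoot z := hz.resolve_left (by simpa using hc0)
    simp only [Set.mem_ofPred_eq, hp', eval_mul, eval_C, star_mul'] at hK
    refine ht z (by simpa [hq0] using hqz) ?_
    have him : ((minpoly ℂ A).eval z * (star (1 - t * Complex.I : ℂ) * star (p.eval z))).im
        = (W z).im + t * (W z).re := by
      rw [mul_left_comm]
      change (_ * W z).im = _
      simp [Complex.mul_im]
    rw [him] at hK
    exact_mod_cast hK.2
  · simp only [Set.mem_iUnion, Set.mem_ofPred_eq, hp', eval_mul, eval_C] at h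
    obtain ⟨z, hz, h⟩ := h
    exact mul_ne_zero hc0 (hmp z (by
      simpa [(minpoly.monic (Matrix.isIntegral A)).ne_zero] using hz)) h

/-- There is a closed set of exceptional pairs of vectors, nowhere dense in each slice over an
admissible first vector. -/
theorem exists_exceptional_set (A : Matrix (Fin n) (Fin n) ℂ) :
    ∃ E : Set ((Fin n → ℂ) × (Fin n → ℂ)), IsClosed E ∧
      (∀ u, FullMinpolyVector A u → interior {v | (u, v) ∈ E} = ∅) ∧
      ∀ u v, (u, v) ∉ E →
        ∃ lam : Fin (minpoly ℂ A).natDegree → ℝ → ℂ, GlobalBranches A u v lam := by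
  have hm : (minpoly ℂ A).Monic := minpoly.monic (Matrix.isIntegral A)
  rcases Nat.eq_zero_or_pos (minpoly ℂ A).natDegree with hl | hl
  · -- the empty matrix: `m_A = 1` and `p_{uv} = 0`
    refine ⟨∅, isClosed_empty, fun u _ => by simp, fun u v _ => ?_⟩
    have hm1 : minpoly ℂ A = 1 := hm.natDegree_eq_zero.1 hl
    have hp0 : puv A u v = 0 := by
      have h := degree_puv_lt A u v
      rw [hm1, degree_one] at h
      exact degree_eq_bot.1 (Nat.WithBot.lt_zero_iff.1 h)
    exact exists_globalBranches A u v (fun z hz => by simpa [hm1] using hz.1)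
      fun z _ τ _ h => by simp [hm1, hp0] at h
  · obtain ⟨g, M, N, hgM, hgN, hroot, hM, hN, hlc⟩ := exists_reduced_logDeriv hl
    exact ⟨exceptionalPairs A M N, isClosed_exceptionalPairs hl hM hN hlc,
      fun u hu => hu.interior_exceptionalPairs hl hroot hgM hM hN hlc,
      fun u v huv => exists_globalBranches_of_notMem_exceptionalPairs hgM hgN huv⟩

end Generic

theorem mainTheorem1 (n : ℕ) (A : Matrix (Fin n) (Fin n) ℂ) :
    -- the admissible `u` are all `u` outside a closed set with empty interior
    (IsClosed {u : Fin n → ℂ | ¬ FullMinpolyVector A u} ∧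
      interior {u : Fin n → ℂ | ¬ FullMinpolyVector A u} = ∅) ∧
    -- fixed admissible `u`, all `v` outside a closed set with empty interior
    (∀ u : Fin n → ℂ, FullMinpolyVector A u →
      ∃ N : Set (Fin n → ℂ), IsClosed N ∧ interior N = ∅ ∧
        ∀ v, v ∉ N → ∃ lam : Fin (minpoly ℂ A).natDegree → ℝ → ℂ, GlobalBranches A u v lam) ∧
    -- all pairs `(u, v)` outside a closed set with empty interior
    (∃ N : Set ((Fin n → ℂ) × (Fin n → ℂ)), IsClosed N ∧ interior N = ∅ ∧
      ∀ u v, (u, v) ∉ N →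
        ∃ lam : Fin (minpoly ℂ A).natDegree → ℝ → ℂ, GlobalBranches A u v lam) := by
  obtain ⟨E, hE, hslice, hgood⟩ := exists_exceptional_set A
  refine ⟨⟨isClosed_not_fullMinpolyVector A, interior_not_fullMinpolyVector A⟩, fun u hu =>
    ⟨{v | (u, v) ∈ E}, hE.preimage (by fun_prop), hslice u hu, fun v hv => hgood u v hv⟩,
    E, hE, ?_, hgood⟩
  rw [← Set.not_nonempty_iff_eq_empty]
  rintro ⟨⟨u, v⟩, huv⟩
  obtain ⟨O₁, O₂, hO₁, hO₂, hu, hv, hsub⟩ := isOpen_prod_iff.1 isOpen_interior u v huv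
  obtain ⟨u', hu', hfull⟩ := (interior_eq_empty_iff_dense_compl.1
    (interior_not_fullMinpolyVector A)).inter_open_nonempty O₁ hO₁ ⟨u, hu⟩
  have hmem : v ∈ interior {v | (u', v) ∈ E} :=
    mem_interior.2 ⟨O₂, fun w hw => show (u', w) ∈ E from interior_subset (hsub ⟨hu', hw⟩), hO₂, hv⟩
  rw [hslice u' (not_not.1 hfull)] at hmem
  exact hmem
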